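/- Let $\mathcal H=\mathbb C^2$, let $\mathcal L(\mathcal H)$ be the space of linear operators on $\mathcal H$, and let $\sigma_1,\sigma_2,\sigma_3$ be the Pauli operators. A TPCP map is a completely positive trace-preserving linear map $\mathcal L(\mathcal H)\to\mathcal L(\mathcal H)$. For an operator $A$ put $\mathcal A_A(O)=AOA^\dagger$. The average fidelity of a linear map $\mathcal E$ on $\mathcal L(\mathcal H)$ is $$\bar F(\mathcal E)=\int_{\|\psi\|=1}\langle\psi|\mathcal E(|\psi\rangle\langle\psi|)|\psi\rangle\,d\psi ,$$ where $d\psi$ is the normalized uniform measure on the unit sphere of $\mathcal H$. Given a TPCP map $\mathcal N$ (the noise), a TPCP map $\mathcal C$ is called an optimal post-control for $\mathcal N$ if $\bar F(\mathcal C'\circ\mathcal N)\le\bar F(\mathcal C\circ\mathcal N)$ for every TPCP map $\mathcal C'$. Theorem. Let $\mathcal N$ be any TPCP map on $\mathcal L(\mathcal H)$, $\dim\mathcal H=2$. (1) There are unitary operators $U,V$ on $\mathcal H$, a TPCP map $\tilde{\mathcal N}$ and real numbers $s_1,s_2,s_3$ such that $$\mathcal N=\mathcal A_U\circ\tilde{\mathcal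 N}\circ\mathcal A_V,\qquad \tilde{\mathcal N}(\sigma_j)=s_j\sigma_j\ (j=1,2,3),\qquad s_i+s_j\ge0\ \text{ for all } i\ne j. \tag{$*$}$$ (2) For all unitary operators $U,V$, every linear map $\tilde{\mathcal N}$ and all real $s_1,s_2,s_3$ that satisfy $(*)$, the unitary conjugation $\mathcal A_V^{-1}\circ\mathcal A_U^{-1}=\mathcal A_{(UV)^\dagger}$ is an optimal post-control for $\mathcal N$, and the optimal average fidelity is $$\bar F\bigl(\mathcal A_{(UV)^\dagger}\circ\mathcal N\bigr)=\frac{6+\sum_{j=1}^3\operatorname{tr}\sigma_j\tilde{\mathcal N}(\sigma_j)}{12}.$$ Moreover, it is the only optimal post-control for $\mathcal N$ if and only if $s_i+s_j>0$ for all $i\ne j$. -/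

import Mathlib

open MeasureTheory
open scoped CStarAlgebra Matrix Matrix.Norms.L2Operator MatrixOrder

noncomputable section

/-- Operators on the Hilbert space `ℂ^d`, as matrices in the standard orthonormal basis. -/
abbrev Op (d : ℕ) : Type := Matrix (Fin d) (Fin d) ℂ

/-- Linear maps on the space of operators. -/
abbrev SuperOp (d : ℕ) : Type := Op d →ₗ[ℂ] Op d

/-- Trace-preserving completely positive maps. -/
def IsTPCP {d : ℕ} (E : SuperOp d) : Prop :=
  (∃ φ : Op d →CP Op d, φ.toLinearMap = E) ∧ ∀ X : Op d, (E X).trace = X.trace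

/-- The map `O ↦ A O A†`. -/
def sandwich {d : ℕ} (A : Op d) : SuperOp d where
  toFun O := A * O * Aᴴ
  map_add' X Y := by rw [Matrix.mul_add, Matrix.add_mul]
  map_smul' c X := by rw [Matrix.mul_smul, Matrix.smul_mul, RingHom.id_apply]

/-- The operator `|ψ⟩⟨ψ|`. -/
def ketbra {d : ℕ} (ψ : EuclideanSpace ℂ (Fin d)) : Op d :=
  Matrix.of fun i j => ψ i * star (ψ j)

/-- The fidelity `⟨ψ|ρ|ψ⟩` of a state `ρ` and the pure state `ψ` (a real number, as `ρ` is
Hermitian). -/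
def fidelity {d : ℕ} (ρ : Op d) (ψ : EuclideanSpace ℂ (Fin d)) : ℝ :=
  (∑ i, ∑ j, star (ψ i) * ρ i j * ψ j).re

/-- The average fidelity of `E`: the mean of `⟨ψ|E(|ψ⟩⟨ψ|)|ψ⟩` over the unit sphere of `ℂ^d`,
for the normalized uniform measure. -/
def avgFidelity {d : ℕ} (E : SuperOp d) : ℝ :=
  ⨍ ψ : Metric.sphere (0 : EuclideanSpace ℂ (Fin d)) 1,
    fidelity (E (ketbra ψ.1)) ψ.1
      ∂((volume : Measure (EuclideanSpace ℂ (Fin d))).toSphere)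

/-- `C` is an optimal post-control for the noise `N`: it is a TPCP map, and no TPCP map gives a
larger average fidelity when it is applied after `N`. -/
def IsOptimalPostControl {d : ℕ} (N C : SuperOp d) : Prop :=
  IsTPCP C ∧ ∀ C' : SuperOp d, IsTPCP C' → avgFidelity (C' ∘ₗ N) ≤ avgFidelity (C ∘ₗ N)

/-- The three Pauli operators. -/
def pauli : Fin 3 → Op 2 :=
  ![!![0, 1; 1, 0], !![0, -Complex.I; Complex.I, 0], !![1, 0; 0, -1]]

/-- `E` is diagonal on the Pauli operators, with real diagonal entries `s 0, s 1, s 2`. -/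
def IsPauliDiagonal (E : SuperOp 2) (s : Fin 3 → ℝ) : Prop :=
  ∀ j, E (pauli j) = (s j : ℂ) • pauli j

/-- The convention on the signs of the diagonal entries: no two of them have a negative sum.
Up to the order of the entries this says `s 0 ≥ s 1 ≥ |s 2|`. -/
def IsSignNormalized (s : Fin 3 → ℝ) : Prop :=
  ∀ i j, i ≠ j → 0 ≤ s i + s j

end

/-! ### Completely positive maps and Kraus decompositions -/

/-! On the Bloch sphere the first moments of the coordinates vanish and the second moments are
δ_ij/3. Hence the average fidelity of a qubit map E depends only on tr E(1) and the diagonal traces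
tr σ_j E(σ_j) (`avgFidelity_eq`).

Let C be a TPCP map with Kraus operators K_r, and put p_j = ∑_r |tr σ_j K_r|²/4. Since σ_j
anticommutes with the other two Pauli operators, tr σ_j C(σ_j) = 2 - 4 ∑_{i ≠ j} p_i
(`IsTPCP.exists_weights`). If N is Pauli-diagonal with entries s, applying C after N therefore
lowers the fidelity by ∑_k p_k (s_{k+1} + s_{k+2})/3 (`avgFidelity_comp_eq_sub`). Nonnegative pair
sums make the identity optimal. If they are all positive, an optimal C has p = 0, so its Kraus
operators are scalars and C is the identity. If one of them is zero, conjugation by the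
corresponding σ_k is a second optimum.

Unitary invariance of the sphere measure carries this over to U N' V
(`isOptimalPostControl_conj_iff`). The normal form comes from maximizing a weighted sum of diagonal
Pauli entries over the compact set of pairs of unitaries (`exists_pauliEntry_diagonal`):
stationarity under rotations kills the off-diagonal entries, and comparison with a pair of opposite
quarter turns gives the sign condition. -/

lemma sandwich_apply {d : ℕ} (A X : Op d) : sandwich A X = A * X * Aᴴ := rfl

lemma sandwich_comp {d : ℕ} (A B : Op d) : sandwich A ∘ₗ sandwich B = sandwich (A * B) := by
  ext1 X
  simp [sandwich_apply, Matrix.conjTranspose_mul, Matrix.mul_assoc]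

lemma sandwich_one {d : ℕ} : sandwich (1 : Op d) = LinearMap.id := by
  ext1 X
  simp [sandwich_apply]

lemma sandwich_conjTranspose_comp {d : ℕ} {U : Op d} (hU : U ∈ Matrix.unitaryGroup (Fin d) ℂ) :
    sandwich Uᴴ ∘ₗ sandwich U = LinearMap.id := by
  rw [sandwich_comp, ← sandwich_one]
  exact congrArg sandwich (Matrix.mem_unitaryGroup_iff'.1 hU)

lemma sandwich_comp_conjTranspose {d : ℕ} {U : Op d} (hU : U ∈ Matrix.unitaryGroup (Fin d) ℂ) :
    sandwich U ∘ₗ sandwich Uᴴ = LinearMap.id := by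
  rw [sandwich_comp, ← sandwich_one]
  exact congrArg sandwich (Matrix.mem_unitaryGroup_iff.1 hU)

lemma conjTranspose_mem_unitaryGroup {d : ℕ} {U : Op d}
    (hU : U ∈ Matrix.unitaryGroup (Fin d) ℂ) : Uᴴ ∈ Matrix.unitaryGroup (Fin d) ℂ :=
  Unitary.star_mem hU

lemma exists_eq_star_mul_self_of_nonneg {A : Type*} [NonUnitalCStarAlgebra A] [PartialOrder A]
    [StarOrderedRing A] {a : A} (ha : 0 ≤ a) : ∃ b, a = star b * b :=
  CStarAlgebra.nonneg_iff_eq_star_mul_self.1 ha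

/-- The map `O ↦ A O A†` is completely positive. -/
noncomputable def sandwichCP {d : ℕ} (A : Op d) : Op d →CP Op d where
  toLinearMap := sandwich A
  map_cstarMatrix_nonneg' k M hM := by
    obtain ⟨B, rfl⟩ := exists_eq_star_mul_self_of_nonneg hM
    -- Multiplying every entry of B by A† on the right absorbs the conjugation, so the image is
    -- again of the form star B' * B'.
    have : (star B * B).map (sandwich A) =
        star (CStarMatrix.ofMatrix (Matrix.of fun i j => B i j * Aᴴ)) *
          CStarMatrix.ofMatrix (Matrix.of fun i j => B i j * Aᴴ) := by
      ext1 i j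
      simp only [CStarMatrix.map_apply, CStarMatrix.mul_apply, map_sum, CStarMatrix.star_apply,
        CStarMatrix.ofMatrix_apply, Matrix.of_apply, sandwich_apply, star_mul,
        Matrix.star_eq_conjTranspose, Matrix.conjTranspose_conjTranspose, Matrix.mul_assoc]
    change 0 ≤ (star B * B).map (sandwich A)
    rw [this]
    exact star_mul_self_nonneg _

lemma isTPCP_sandwich {d : ℕ} {U : Op d} (hU : U ∈ Matrix.unitaryGroup (Fin d) ℂ) :
    IsTPCP (sandwich U) := by
  refine ⟨⟨sandwichCP U, rfl⟩, fun X => ?_⟩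
  have h : Uᴴ * U = 1 := Matrix.mem_unitaryGroup_iff'.1 hU
  rw [sandwich_apply, Matrix.trace_mul_comm, ← Matrix.mul_assoc, h, Matrix.one_mul]

lemma IsTPCP.comp {d : ℕ} {E F : SuperOp d} (hE : IsTPCP E) (hF : IsTPCP F) :
    IsTPCP (E ∘ₗ F) := by
  obtain ⟨⟨φ, rfl⟩, hφ⟩ := hE
  obtain ⟨⟨χ, rfl⟩, hχ⟩ := hF
  refine ⟨⟨⟨φ.toLinearMap ∘ₗ χ.toLinearMap, fun k M hM => ?_⟩, rfl⟩, fun X => ?_⟩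
  · exact φ.map_cstarMatrix_nonneg' k _ (χ.map_cstarMatrix_nonneg' k M hM)
  · exact (hφ _).trans (hχ X)

/-- **Kraus decomposition** of a completely positive map on matrices. -/
lemma exists_kraus {d : ℕ} (φ : Op d →CP Op d) :
    ∃ K : Fin d × Fin d → Op d, ∀ X, φ.toLinearMap X = ∑ r, K r * X * (K r)ᴴ := by
  rcases d.eq_zero_or_pos with rfl | hd
  · exact ⟨fun _ => 0, fun X => Subsingleton.elim _ _⟩
  let z : Fin d := ⟨0, hd⟩
  -- Row z of R consists of the matrix units e_zj and the other rows vanish, so star R * R is the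
  -- block matrix (e_ij). Its image under φ is the Choi matrix, which is thus positive.
  let R : CStarMatrix (Fin d) (Fin d) (Op d) :=
    CStarMatrix.ofMatrix (Matrix.of fun r j => if r = z then Matrix.single z j 1 else 0)
  obtain ⟨B, hB⟩ := exists_eq_star_mul_self_of_nonneg
    (φ.map_cstarMatrix_nonneg' d (star R * R) (star_mul_self_nonneg R))
  have hent (i j : Fin d) : φ.toLinearMap (Matrix.single i j 1) = ∑ r, (B r i)ᴴ * B r j := by
    have h := congrFun (congrFun hB i) j
    simp only [CStarMatrix.map_apply, CStarMatrix.mul_apply, CStarMatrix.star_apply] at h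
    refine Eq.trans ?_ h
    congr 1
    simp [R, CStarMatrix.ofMatrix_apply, Matrix.star_eq_conjTranspose]
  -- Each row c of the blocks in block row r of the factor B gives, after conjugation, one Kraus
  -- operator.
  refine ⟨fun rc => Matrix.of fun a i => star (B rc.1 i rc.2 a), fun X => ?_⟩
  have hX : X = ∑ i, ∑ j, X i j • Matrix.single i j (1 : ℂ) := by
    conv_lhs => rw [Matrix.matrix_eq_sum_single X]
    simp
  conv_lhs => rw [hX]
  simp only [map_sum, map_smul]
  change (∑ i, ∑ j, X i j • φ.toLinearMap (Matrix.single i j 1)) = _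
  simp only [hent]
  ext a b
  simp only [Matrix.sum_apply, Matrix.smul_apply, Matrix.mul_apply, Matrix.conjTranspose_apply,
    Matrix.of_apply, star_star, smul_eq_mul, Fintype.sum_prod_type, Finset.mul_sum,
    Finset.sum_mul]
  calc _ = ∑ j, ∑ i, ∑ r, ∑ c, X i j * (star (B r i c a) * B r j c b) := Finset.sum_comm
    _ = ∑ j, ∑ r, ∑ i, ∑ c, X i j * (star (B r i c a) * B r j c b) :=
        Finset.sum_congr rfl fun _ _ => Finset.sum_comm
    _ = ∑ r, ∑ j, ∑ i, ∑ c, X i j * (star (B r i c a) * B r j c b) := Finset.sum_comm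
    _ = ∑ r, ∑ j, ∑ c, ∑ i, X i j * (star (B r i c a) * B r j c b) :=
        Finset.sum_congr rfl fun _ _ => Finset.sum_congr rfl fun _ _ => Finset.sum_comm
    _ = ∑ r, ∑ c, ∑ j, ∑ i, X i j * (star (B r i c a) * B r j c b) :=
        Finset.sum_congr rfl fun _ _ => Finset.sum_comm
    _ = _ := by
        refine Finset.sum_congr rfl fun _ _ => Finset.sum_congr rfl fun _ _ =>
          Finset.sum_congr rfl fun _ _ => Finset.sum_congr rfl fun _ _ => by ring

lemma IsTPCP.exists_kraus {d : ℕ} {E : SuperOp d} (hE : IsTPCP E) :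
    ∃ K : Fin d × Fin d → Op d, ∀ X, E X = ∑ r, K r * X * (K r)ᴴ := by
  obtain ⟨⟨φ, rfl⟩, -⟩ := hE
  exact _root_.exists_kraus φ

/-- A completely positive map commutes with the adjoint. -/
lemma IsTPCP.map_conjTranspose {d : ℕ} {E : SuperOp d} (hE : IsTPCP E) (X : Op d) :
    E Xᴴ = (E X)ᴴ := by
  obtain ⟨K, hK⟩ := hE.exists_kraus
  simp [hK, Matrix.conjTranspose_sum, Matrix.conjTranspose_mul, Matrix.mul_assoc]

/-! ### Pauli operators and rotations about the coordinate axes -/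

lemma pauli_zero : pauli 0 = !![0, 1; 1, 0] := rfl
lemma pauli_one : pauli 1 = !![0, -Complex.I; Complex.I, 0] := rfl
lemma pauli_two : pauli 2 = !![1, 0; 0, -1] := rfl

lemma forall_fin_three {p : Fin 3 → Prop} : (∀ i, p i) ↔ p 0 ∧ p 1 ∧ p 2 := by
  refine ⟨fun h => ⟨h 0, h 1, h 2⟩, fun h i => ?_⟩
  fin_cases i
  exacts [h.1, h.2.1, h.2.2]

lemma pauli_conjTranspose (j : Fin 3) : (pauli j)ᴴ = pauli j := by
  revert j
  rw [forall_fin_three]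
  refine ⟨?_, ?_, ?_⟩ <;> ext a b <;> fin_cases a <;> fin_cases b <;>
    simp [pauli_zero, pauli_one, pauli_two]

lemma trace_pauli (j : Fin 3) : (pauli j).trace = 0 := by
  revert j
  rw [forall_fin_three]
  simp [pauli_zero, pauli_one, pauli_two, Matrix.trace_fin_two]

lemma trace_pauli_mul_pauli (i j : Fin 3) :
    (pauli i * pauli j).trace = if i = j then 2 else 0 := by
  revert i j
  simp only [forall_fin_three]
  simp [pauli_zero, pauli_one, pauli_two, Matrix.trace_fin_two]
  norm_num

/-- Expansion of an operator of a qubit in the Pauli basis. -/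
lemma eq_pauli_expansion (X : Op 2) :
    X = (1 / 2 : ℂ) • (X.trace • (1 : Op 2) + ∑ j, (pauli j * X).trace • pauli j) := by
  have hI := Complex.I_mul_I
  ext a b
  fin_cases a <;> fin_cases b <;>
    simp [Fin.sum_univ_three, pauli_zero, pauli_one, pauli_two, Matrix.trace_fin_two,
      Matrix.mul_apply] <;>
    first
    | ring1
    | linear_combination ((X 0 1 - X 1 0) / 2) * hI
    | linear_combination ((X 1 0 - X 0 1) / 2) * hI

/-- The rotation about the axis `k` with half-angle cosine `c` and half-angle sine `s`. -/
noncomputable def axisRotation (k : Fin 3) (c s : ℝ) : Op 2 :=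
  (c : ℂ) • 1 + ((s : ℂ) * Complex.I) • pauli k

lemma conjTranspose_axisRotation (k : Fin 3) (c s : ℝ) :
    (axisRotation k c s)ᴴ = axisRotation k c (-s) := by
  simp [axisRotation, pauli_conjTranspose, Complex.conj_ofReal]

lemma pauli_mul_self (k : Fin 3) : pauli k * pauli k = 1 := by
  revert k
  rw [forall_fin_three]
  refine ⟨?_, ?_, ?_⟩ <;> ext a b <;> fin_cases a <;> fin_cases b <;>
    simp [pauli_zero, pauli_one, pauli_two, Matrix.mul_apply]

lemma pauli_mem_unitaryGroup (k : Fin 3) : pauli k ∈ Matrix.unitaryGroup (Fin 2) ℂ := by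
  rw [Matrix.mem_unitaryGroup_iff, Matrix.star_eq_conjTranspose, pauli_conjTranspose,
    pauli_mul_self]

lemma axisRotation_mem_unitaryGroup (k : Fin 3) {c s : ℝ} (h : c ^ 2 + s ^ 2 = 1) :
    axisRotation k c s ∈ Matrix.unitaryGroup (Fin 2) ℂ := by
  have h' : (c : ℂ) ^ 2 + (s : ℂ) ^ 2 = 1 := by exact_mod_cast h
  rw [Matrix.mem_unitaryGroup_iff, Matrix.star_eq_conjTranspose, conjTranspose_axisRotation]
  simp only [axisRotation, Matrix.mul_add, Matrix.add_mul, Matrix.smul_mul, Matrix.mul_smul,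
    Matrix.one_mul, Matrix.mul_one, pauli_mul_self, Complex.ofReal_neg]
  match_scalars
  · linear_combination h' - (s : ℂ) ^ 2 * Complex.I_sq
  · ring

/-- Indices add modulo 3, so one formula covers all cyclic products. -/
lemma pauli_mul_pauli_add_one (k : Fin 3) :
    pauli k * pauli (k + 1) = Complex.I • pauli (k + 2) := by
  revert k
  rw [forall_fin_three]
  refine ⟨?_, ?_, ?_⟩ <;> ext a b <;> fin_cases a <;> fin_cases b <;>
    simp [pauli_zero, pauli_one, pauli_two, Matrix.mul_apply]

lemma pauli_add_one_mul_pauli (k : Fin 3) :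
    pauli (k + 1) * pauli k = -Complex.I • pauli (k + 2) := by
  have := congrArg Matrix.conjTranspose (pauli_mul_pauli_add_one k)
  simpa [Matrix.conjTranspose_mul, pauli_conjTranspose] using this

lemma pauli_mul_pauli_add_two (k : Fin 3) :
    pauli k * pauli (k + 2) = -Complex.I • pauli (k + 1) := by
  revert k
  rw [forall_fin_three]
  refine ⟨?_, ?_, ?_⟩ <;> ext a b <;> fin_cases a <;> fin_cases b <;>
    simp [pauli_zero, pauli_one, pauli_two, Matrix.mul_apply]

lemma pauli_add_two_mul_pauli (k : Fin 3) :
    pauli (k + 2) * pauli k = Complex.I • pauli (k + 1) := by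
  have := congrArg Matrix.conjTranspose (pauli_mul_pauli_add_two k)
  simpa [Matrix.conjTranspose_mul, pauli_conjTranspose] using this

lemma sandwich_axisRotation_self (k : Fin 3) {c s : ℝ} (h : c ^ 2 + s ^ 2 = 1) :
    sandwich (axisRotation k c s) (pauli k) = pauli k := by
  have h' : (c : ℂ) ^ 2 + (s : ℂ) ^ 2 = 1 := by exact_mod_cast h
  rw [sandwich_apply, conjTranspose_axisRotation]
  simp only [axisRotation, Matrix.mul_add, Matrix.add_mul, Matrix.smul_mul, Matrix.mul_smul,
    Matrix.one_mul, Matrix.mul_one, pauli_mul_self, Complex.ofReal_neg]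
  match_scalars
  · linear_combination h' - (s : ℂ) ^ 2 * Complex.I_sq
  · ring

/-- The numbers c² - s² and 2cs are the cosine and sine of the full angle. By anticommutation with
`pauli k` no term c² + s² arises, so no normalization is needed. -/
lemma sandwich_axisRotation_add_one (k : Fin 3) (c s : ℝ) :
    sandwich (axisRotation k c s) (pauli (k + 1)) =
      ((c ^ 2 - s ^ 2 : ℝ) : ℂ) • pauli (k + 1) - ((2 * c * s : ℝ) : ℂ) • pauli (k + 2) := by
  rw [sandwich_apply, conjTranspose_axisRotation]
  simp only [axisRotation, Matrix.mul_add, Matrix.add_mul, Matrix.smul_mul, Matrix.mul_smul,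
    Matrix.one_mul, Matrix.mul_one, pauli_mul_pauli_add_one, pauli_add_one_mul_pauli,
    pauli_add_two_mul_pauli,
    Complex.ofReal_neg, Complex.ofReal_sub, Complex.ofReal_pow, Complex.ofReal_mul,
    Complex.ofReal_ofNat]
  match_scalars
  · linear_combination (s : ℂ) ^ 2 * Complex.I_sq * (1 - Complex.I ^ 2)
  · linear_combination 2 * (c : ℂ) * s * Complex.I_sq

lemma sandwich_axisRotation_add_two (k : Fin 3) (c s : ℝ) :
    sandwich (axisRotation k c s) (pauli (k + 2)) =
      ((c ^ 2 - s ^ 2 : ℝ) : ℂ) • pauli (k + 2) + ((2 * c * s : ℝ) : ℂ) • pauli (k + 1) := by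
  rw [sandwich_apply, conjTranspose_axisRotation]
  simp only [axisRotation, Matrix.mul_add, Matrix.add_mul, Matrix.smul_mul, Matrix.mul_smul,
    Matrix.one_mul, Matrix.mul_one, pauli_mul_pauli_add_two, pauli_add_two_mul_pauli,
    pauli_add_one_mul_pauli,
    Complex.ofReal_neg, Complex.ofReal_sub, Complex.ofReal_pow, Complex.ofReal_mul,
    Complex.ofReal_ofNat]
  match_scalars
  · linear_combination (s : ℂ) ^ 2 * Complex.I_sq * (1 - Complex.I ^ 2)
  · linear_combination -2 * (c : ℂ) * s * Complex.I_sq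

/-! ### Uniform averages over the unit sphere -/

/-- The linear isometry of `ℂ^d` given by a unitary matrix. -/
noncomputable def unitaryIsometry {d : ℕ} (U : Matrix.unitaryGroup (Fin d) ℂ) :
    EuclideanSpace ℂ (Fin d) ≃ₗᵢ[ℝ] EuclideanSpace ℂ (Fin d) :=
  let u : unitary (EuclideanSpace ℂ (Fin d) →L[ℂ] EuclideanSpace ℂ (Fin d)) :=
    ⟨Matrix.toEuclideanCLM (𝕜 := ℂ) (n := Fin d) U, Unitary.map_mem _ U.2⟩
  { toLinearEquiv := (Unitary.linearIsometryEquiv u).toLinearEquiv.restrictScalars ℝ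
    norm_map' := (Unitary.linearIsometryEquiv u).norm_map }

lemma ketbra_unitaryIsometry {d : ℕ} (U : Matrix.unitaryGroup (Fin d) ℂ)
    (ψ : EuclideanSpace ℂ (Fin d)) :
    ketbra (unitaryIsometry U ψ) = sandwich (U : Op d) (ketbra ψ) := by
  have h (i : Fin d) : unitaryIsometry U ψ i = ∑ j, (U : Op d) i j * ψ j := rfl
  ext i j
  simp only [ketbra, Matrix.of_apply, h, sandwich_apply, Matrix.mul_apply,
    Matrix.conjTranspose_apply, star_sum, star_mul', Finset.sum_mul, Finset.mul_sum]
  refine Finset.sum_congr rfl fun _ _ => Finset.sum_congr rfl fun _ _ => by ring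

/-- The action of a linear isometry on the unit sphere. -/
def LinearIsometryEquiv.sphereHomeomorph {E : Type*} [NormedAddCommGroup E] [NormedSpace ℝ E]
    (e : E ≃ₗᵢ[ℝ] E) : Metric.sphere (0 : E) 1 ≃ₜ Metric.sphere (0 : E) 1 :=
  e.toHomeomorph.subtype fun x => by simp

open scoped Pointwise in
-- Up to a constant, `toSphere` measures a set by the volume of the cone over it, and an isometry
-- carries cones to cones and preserves volume.
lemma LinearIsometryEquiv.measurePreserving_sphereHomeomorph {E : Type*} [NormedAddCommGroup E]
    [InnerProductSpace ℝ E] [FiniteDimensional ℝ E] [MeasurableSpace E] [BorelSpace E]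
    (e : E ≃ₗᵢ[ℝ] E) :
    MeasurePreserving e.sphereHomeomorph (volume : Measure E).toSphere
      (volume : Measure E).toSphere := by
  refine ⟨e.sphereHomeomorph.measurable, ?_⟩
  ext s hs
  rw [Measure.map_apply e.sphereHomeomorph.measurable hs, Measure.toSphere_apply' _ hs,
    Measure.toSphere_apply' _ (e.sphereHomeomorph.measurable hs)]
  congr 1
  have : e ⁻¹' (Set.Ioo (0 : ℝ) 1 • (Subtype.val '' s)) =
      Set.Ioo (0 : ℝ) 1 • (Subtype.val '' (e.sphereHomeomorph ⁻¹' s)) := by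
    ext x
    simp only [Set.mem_preimage, Set.mem_smul, Set.mem_image]
    constructor
    · rintro ⟨r, hr, _, ⟨y, hy, rfl⟩, h⟩
      refine ⟨r, hr, _, ⟨e.sphereHomeomorph.symm y, by simpa using hy, rfl⟩, ?_⟩
      apply e.injective
      rw [map_smul, ← h]
      congr 1
      exact congrArg Subtype.val (e.sphereHomeomorph.apply_symm_apply y)
    · rintro ⟨r, hr, _, ⟨y, hy, rfl⟩, rfl⟩
      exact ⟨r, hr, _, ⟨_, hy, rfl⟩, (e.toLinearEquiv.map_smul r _).symm⟩
  rw [← this]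
  exact (e.measurePreserving.measure_preimage_equiv (f := e.toMeasurableEquiv) _)

/-- The mean of a function of pure states. -/
noncomputable def sphereMean (d : ℕ) (g : EuclideanSpace ℂ (Fin d) → ℝ) : ℝ :=
  ⨍ ψ : Metric.sphere (0 : EuclideanSpace ℂ (Fin d)) 1, g ψ.1
    ∂((volume : Measure (EuclideanSpace ℂ (Fin d))).toSphere)

lemma sphereMean_comp_unitaryIsometry {d : ℕ} (U : Matrix.unitaryGroup (Fin d) ℂ)
    (g : EuclideanSpace ℂ (Fin d) → ℝ) :
    sphereMean d (fun ψ => g (unitaryIsometry U ψ)) = sphereMean d g := by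
  rw [sphereMean, sphereMean, average_eq, average_eq]
  congr 1
  exact ((unitaryIsometry U).measurePreserving_sphereHomeomorph).integral_comp
    (unitaryIsometry U).sphereHomeomorph.measurableEmbedding (fun ψ => g ψ.1)

lemma sphereMean_congr {d : ℕ} {f g : EuclideanSpace ℂ (Fin d) → ℝ}
    (h : ∀ ψ, ‖ψ‖ = 1 → f ψ = g ψ) : sphereMean d f = sphereMean d g := by
  rw [sphereMean, sphereMean]
  congr 1
  ext ψ
  exact h _ (by simp)

lemma integrable_sphere {d : ℕ} {g : EuclideanSpace ℂ (Fin d) → ℝ} (hg : Continuous g) :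
    Integrable (fun ψ : Metric.sphere (0 : EuclideanSpace ℂ (Fin d)) 1 => g ψ.1)
      ((volume : Measure (EuclideanSpace ℂ (Fin d))).toSphere) :=
  ((hg.comp continuous_subtype_val).integrable_of_hasCompactSupport
    (HasCompactSupport.of_compactSpace _))

lemma sphereMean_add {d : ℕ} {f g : EuclideanSpace ℂ (Fin d) → ℝ} (hf : Continuous f)
    (hg : Continuous g) : sphereMean d (fun ψ => f ψ + g ψ) = sphereMean d f + sphereMean d g := by
  simp only [sphereMean, average_eq]
  rw [integral_add (integrable_sphere hf) (integrable_sphere hg), smul_add]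

lemma sphereMean_sum {d : ℕ} {ι : Type*} (s : Finset ι) {f : ι → EuclideanSpace ℂ (Fin d) → ℝ}
    (hf : ∀ i, Continuous (f i)) :
    sphereMean d (fun ψ => ∑ i ∈ s, f i ψ) = ∑ i ∈ s, sphereMean d (f i) := by
  simp only [sphereMean, average_eq]
  rw [integral_finsetSum _ fun i _ => integrable_sphere (hf i), Finset.smul_sum]

lemma sphereMean_const_mul {d : ℕ} (c : ℝ) (f : EuclideanSpace ℂ (Fin d) → ℝ) :
    sphereMean d (fun ψ => c * f ψ) = c * sphereMean d f := by
  simp only [sphereMean, average_eq]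
  rw [integral_const_mul, smul_eq_mul, smul_eq_mul, mul_left_comm]

/-- For d = 0 the sphere is empty and the average takes its default value 0. -/
lemma sphereMean_const {d : ℕ} [NeZero d] (c : ℝ) : sphereMean d (fun _ => c) = c := by
  have : NeZero (volume : Measure (EuclideanSpace ℂ (Fin d))).toSphere :=
    ⟨Measure.toSphere_ne_zero _⟩
  exact average_const _ _

lemma fidelity_eq_trace {d : ℕ} (ρ : Op d) (ψ : EuclideanSpace ℂ (Fin d)) :
    fidelity ρ ψ = (ρ * ketbra ψ).trace.re := by
  simp only [fidelity, Matrix.trace, Matrix.diag, Matrix.mul_apply, ketbra, Matrix.of_apply]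
  congr 1
  refine Finset.sum_congr rfl fun _ _ => Finset.sum_congr rfl fun _ _ => by ring

lemma avgFidelity_eq_sphereMean {d : ℕ} (E : SuperOp d) :
    avgFidelity E = sphereMean d fun ψ => (E (ketbra ψ) * ketbra ψ).trace.re := by
  simp only [avgFidelity, fidelity_eq_trace, sphereMean]

/-- The average fidelity is invariant under conjugation with a unitary. -/
lemma avgFidelity_conj {d : ℕ} {U : Op d} (hU : U ∈ Matrix.unitaryGroup (Fin d) ℂ)
    (E : SuperOp d) : avgFidelity (sandwich U ∘ₗ E ∘ₗ sandwich Uᴴ) = avgFidelity E := by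
  rw [avgFidelity_eq_sphereMean, avgFidelity_eq_sphereMean,
    ← sphereMean_comp_unitaryIsometry ⟨U, hU⟩]
  congr 1
  ext ψ
  rw [ketbra_unitaryIsometry]
  have h : sandwich Uᴴ (sandwich U (ketbra ψ)) = ketbra ψ :=
    LinearMap.congr_fun (sandwich_conjTranspose_comp hU) _
  have h1 : Uᴴ * U = 1 := Matrix.mem_unitaryGroup_iff'.1 hU
  simp only [LinearMap.comp_apply, h]
  simp only [sandwich_apply]
  congr 1
  calc _ = (U * (E (ketbra ψ) * (Uᴴ * U) * ketbra ψ * Uᴴ)).trace := by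
        simp only [Matrix.mul_assoc]
    _ = _ := by
        rw [Matrix.trace_mul_comm, h1, Matrix.mul_one, Matrix.mul_assoc, h1, Matrix.mul_one]

/-! ### The average fidelity of a qubit map -/

/-- The Bloch coordinates of a pure state. -/
noncomputable def blochCoord (j : Fin 3) (ψ : EuclideanSpace ℂ (Fin 2)) : ℝ :=
  (pauli j * ketbra ψ).trace.re

lemma trace_pauli_mul_isReal (j : Fin 3) {X : Op 2} (hX : Xᴴ = X) :
    (((pauli j * X).trace.re : ℝ) : ℂ) = (pauli j * X).trace := by
  rw [← Complex.conj_eq_iff_re]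
  change star _ = _
  rw [← Matrix.trace_conjTranspose, Matrix.conjTranspose_mul, hX, pauli_conjTranspose,
    Matrix.trace_mul_comm]

lemma conjTranspose_ketbra {d : ℕ} (ψ : EuclideanSpace ℂ (Fin d)) : (ketbra ψ)ᴴ = ketbra ψ := by
  ext i j
  simp [ketbra, mul_comm]

lemma trace_ketbra {d : ℕ} {ψ : EuclideanSpace ℂ (Fin d)} (h : ‖ψ‖ = 1) :
    (ketbra ψ).trace = 1 := by
  have h2 := EuclideanSpace.norm_sq_eq ψ
  rw [h] at h2
  have h3 : (∑ i, (‖ψ i‖ : ℂ) ^ 2) = 1 := by exact_mod_cast h2.symm.trans (one_pow 2)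
  rw [← h3]
  simp only [Matrix.trace, Matrix.diag, ketbra, Matrix.of_apply]
  refine Finset.sum_congr rfl fun i _ => ?_
  exact Complex.mul_conj' _

lemma ketbra_eq_bloch {ψ : EuclideanSpace ℂ (Fin 2)} (h : ‖ψ‖ = 1) :
    ketbra ψ = (1 / 2 : ℂ) • ((1 : Op 2) + ∑ j, (blochCoord j ψ : ℂ) • pauli j) := by
  conv_lhs => rw [eq_pauli_expansion (ketbra ψ)]
  simp only [trace_ketbra h, one_smul, blochCoord,
    trace_pauli_mul_isReal _ (conjTranspose_ketbra ψ)]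

/-- A pure state is a projection of trace one; in Bloch coordinates tr ρ² = 1 reads (1 + |n|²)/2 =
1. -/
lemma sum_blochCoord_sq {ψ : EuclideanSpace ℂ (Fin 2)} (h : ‖ψ‖ = 1) :
    ∑ j, blochCoord j ψ * blochCoord j ψ = 1 := by
  have h1 : ketbra ψ * ketbra ψ = ketbra ψ := by
    have := trace_ketbra h
    simp only [Matrix.trace, Matrix.diag, ketbra, Matrix.of_apply] at this
    ext i j
    simp only [Matrix.mul_apply, ketbra, Matrix.of_apply]
    calc _ = ψ i * star (ψ j) * ∑ k, ψ k * star (ψ k) := by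
          rw [Finset.mul_sum]
          exact Finset.sum_congr rfl fun _ _ => by ring
      _ = _ := by rw [this, mul_one]
  have h2 : (ketbra ψ * ketbra ψ).trace = 1 := by rw [h1, trace_ketbra h]
  nth_rw 1 [ketbra_eq_bloch h] at h2
  simp only [Matrix.smul_mul, Matrix.add_mul, Matrix.one_mul, Matrix.sum_mul, Matrix.trace_smul,
    Matrix.trace_add, Matrix.trace_sum, trace_ketbra h, smul_eq_mul] at h2
  have h3 (j) : (pauli j * ketbra ψ).trace = (blochCoord j ψ : ℂ) :=
    (trace_pauli_mul_isReal j (conjTranspose_ketbra ψ)).symm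
  simp only [h3] at h2
  have h4 : ((∑ j, blochCoord j ψ * blochCoord j ψ : ℝ) : ℂ) = (1 : ℝ) := by
    push_cast
    linear_combination 2 * h2
  exact_mod_cast h4

lemma continuous_blochCoord (j : Fin 3) : Continuous (blochCoord j) := by
  refine Complex.continuous_re.comp (Continuous.matrix_trace (Continuous.matrix_mul
    continuous_const (continuous_matrix fun a b => ?_)))
  simp only [ketbra, Matrix.of_apply]
  fun_prop

lemma blochCoord_unitaryIsometry (j : Fin 3) (U : Matrix.unitaryGroup (Fin 2) ℂ)
    (ψ : EuclideanSpace ℂ (Fin 2)) :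
    blochCoord j (unitaryIsometry U ψ) =
      (sandwich (U : Op 2)ᴴ (pauli j) * ketbra ψ).trace.re := by
  rw [blochCoord, ketbra_unitaryIsometry, sandwich_apply, sandwich_apply,
    Matrix.conjTranspose_conjTranspose, ← Matrix.mul_assoc, Matrix.trace_mul_comm]
  simp only [Matrix.mul_assoc]

/-- The mean of a function of pure states is invariant under rotations of the Bloch sphere. -/
lemma sphereMean_rotate (k : Fin 3) {c s : ℝ} (h : c ^ 2 + s ^ 2 = 1) (g : (Fin 3 → ℝ) → ℝ) :
    sphereMean 2 (fun ψ => g fun j => blochCoord j ψ) =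
      sphereMean 2 (fun ψ => g fun j =>
        if j = k then blochCoord k ψ
        else if j = k + 1 then
          (c ^ 2 - s ^ 2) * blochCoord (k + 1) ψ + 2 * c * s * blochCoord (k + 2) ψ
        else (c ^ 2 - s ^ 2) * blochCoord (k + 2) ψ - 2 * c * s * blochCoord (k + 1) ψ) := by
  -- The coordinates transform by the adjoint rotation, whose half-angle sine is -s.
  have h' : c ^ 2 + (-s) ^ 2 = 1 := by rw [neg_sq, h]
  rw [← sphereMean_comp_unitaryIsometry ⟨_, axisRotation_mem_unitaryGroup k h⟩]
  congr 1
  ext ψ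
  congr 1
  ext j
  rw [blochCoord_unitaryIsometry]
  dsimp only
  rw [conjTranspose_axisRotation]
  have hj : j = k ∨ j = k + 1 ∨ j = k + 2 := by decide +revert
  have hk1 : k + 1 ≠ k := by clear * -; decide +revert
  have hk2 : k + 2 ≠ k := by clear * -; decide +revert
  have hk3 : k + 2 ≠ k + 1 := by clear * -; decide +revert
  rcases hj with rfl | rfl | rfl
  · rw [sandwich_axisRotation_self _ h', if_pos rfl, blochCoord]
  · rw [sandwich_axisRotation_add_one, if_neg hk1, if_pos rfl]
    simp only [Matrix.sub_mul, Matrix.smul_mul, Matrix.trace_sub, Matrix.trace_smul, blochCoord,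
      Complex.sub_re, smul_eq_mul, Complex.re_ofReal_mul]
    ring
  · rw [sandwich_axisRotation_add_two, if_neg hk2, if_neg hk3]
    simp only [Matrix.add_mul, Matrix.smul_mul, Matrix.trace_add, Matrix.trace_smul, blochCoord,
      Complex.add_re, smul_eq_mul, Complex.re_ofReal_mul]
    ring

/-- A half turn about the axis k. Unitaries act on Bloch vectors by rotations, so two signs change
together. -/
lemma sphereMean_flip (k : Fin 3) (g : (Fin 3 → ℝ) → ℝ) :
    sphereMean 2 (fun ψ => g fun j => blochCoord j ψ) =
      sphereMean 2 (fun ψ => g fun j => (if j = k then 1 else -1) * blochCoord j ψ) := by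
  rw [sphereMean_rotate k (c := 0) (s := 1) (by norm_num)]
  congr 1
  ext ψ
  congr 1
  ext j
  have hj : j = k ∨ j = k + 1 ∨ j = k + 2 := by decide +revert
  have hk1 : k + 1 ≠ k := by clear * -; decide +revert
  have hk2 : k + 2 ≠ k := by clear * -; decide +revert
  have hk3 : k + 2 ≠ k + 1 := by clear * -; decide +revert
  rcases hj with rfl | rfl | rfl <;> simp [hk1, hk2, hk3]

lemma sphereMean_blochCoord (j : Fin 3) : sphereMean 2 (blochCoord j) = 0 := by
  have h := sphereMean_flip (j + 1) fun n => n j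
  have hj : j ≠ j + 1 := by clear h; decide +revert
  simp only [if_neg hj, sphereMean_const_mul] at h
  change sphereMean 2 (blochCoord j) = -1 * sphereMean 2 (blochCoord j) at h
  linarith

/-- Quarter turns make the three mean squares equal, and they add up to 1. A half turn about the
axis i changes the sign of a mixed product. -/
lemma sphereMean_blochCoord_mul (i j : Fin 3) :
    sphereMean 2 (fun ψ => blochCoord i ψ * blochCoord j ψ) = if i = j then 1 / 3 else 0 := by
  split_ifs with hij
  · subst hij
    have hsq (k : Fin 3) : sphereMean 2 (fun ψ => blochCoord (k + 1) ψ * blochCoord (k + 1) ψ) =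
        sphereMean 2 (fun ψ => blochCoord (k + 2) ψ * blochCoord (k + 2) ψ) := by
      have hs : (√2 / 2) ^ 2 = (1 / 2 : ℝ) := by
        rw [div_pow, Real.sq_sqrt (by norm_num)]
        norm_num
      have h := sphereMean_rotate k (c := √2 / 2) (s := √2 / 2) (by rw [hs]; norm_num)
        fun n => n (k + 1) * n (k + 1)
      have hk1 : k + 1 ≠ k := by clear * -; decide +revert
      have hs' : 2 * (√2 / 2) * (√2 / 2) = 1 := by linear_combination 2 * hs
      simpa only [if_neg hk1, if_true, sub_self, zero_mul, zero_add, hs', one_mul] using h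
    have h2 := hsq 2
    have h0 := hsq 0
    have hsum : ∑ j, sphereMean 2 (fun ψ => blochCoord j ψ * blochCoord j ψ) = 1 := by
      rw [← sphereMean_sum (f := fun j ψ => blochCoord j ψ * blochCoord j ψ) _
          fun j => (continuous_blochCoord j).mul (continuous_blochCoord j),
        sphereMean_congr fun ψ hψ => sum_blochCoord_sq hψ, sphereMean_const]
    rw [Fin.sum_univ_three] at hsum
    have e1 : (2 : Fin 3) + 1 = 0 := rfl
    have e2 : (2 : Fin 3) + 2 = 1 := rfl
    rw [e1, e2] at h2
    rw [zero_add, zero_add] at h0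
    revert i
    rw [forall_fin_three]
    refine ⟨?_, ?_, ?_⟩ <;> linarith
  · have h := sphereMean_flip i fun n => n i * n j
    simp only [if_neg (Ne.symm hij), if_true] at h
    have h' : sphereMean 2 (fun ψ => blochCoord i ψ * blochCoord j ψ) =
        -1 * sphereMean 2 (fun ψ => blochCoord i ψ * blochCoord j ψ) := by
      rw [← sphereMean_const_mul]
      refine h.trans ?_
      congr 1
      ext ψ
      ring
    linarith

/-- The average fidelity of a linear map of a qubit through its matrix in the Pauli basis. -/
lemma avgFidelity_eq (E : SuperOp 2) :
    avgFidelity E =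
      ((E 1).trace.re + (1 / 3) * ∑ j, (pauli j * E (pauli j)).trace.re) / 4 := by
  have hc := continuous_blochCoord
  -- Inserting ρ = (1 + n·σ)/2 twice splits the fidelity into parts constant, linear and quadratic
  -- in n.
  have key : avgFidelity E = sphereMean 2 fun ψ => (1 / 4) * ((E 1).trace.re +
      ∑ j, ((E (pauli j)).trace.re + (E 1 * pauli j).trace.re) * blochCoord j ψ +
      ∑ i, ∑ j, (E (pauli i) * pauli j).trace.re * (blochCoord i ψ * blochCoord j ψ)) := by
    rw [avgFidelity_eq_sphereMean]
    refine sphereMean_congr fun ψ hψ => ?_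
    have h2 : (1 / 2 : ℂ) = ((1 / 2 : ℝ) : ℂ) := by push_cast; rfl
    rw [ketbra_eq_bloch hψ, h2]
    simp only [map_smul, map_add, Matrix.smul_mul, Matrix.mul_smul, Matrix.add_mul,
      Matrix.mul_add, Matrix.mul_one, Matrix.trace_smul, Matrix.trace_add, smul_eq_mul,
      Complex.re_ofReal_mul, Complex.add_re, Fin.sum_univ_three]
    ring
  rw [key, sphereMean_const_mul, sphereMean_add (by fun_prop) (by fun_prop),
    sphereMean_add (by fun_prop) (by fun_prop), sphereMean_const,
    sphereMean_sum _ (fun _ => by fun_prop), sphereMean_sum _ (fun _ => by fun_prop)]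
  have hs (i : Fin 3) : sphereMean 2 (fun ψ => ∑ j, (E (pauli i) * pauli j).trace.re *
      (blochCoord i ψ * blochCoord j ψ)) = (1 / 3) * (pauli i * E (pauli i)).trace.re := by
    rw [sphereMean_sum _ (fun _ => by fun_prop)]
    simp only [sphereMean_const_mul, sphereMean_blochCoord_mul]
    simp [Matrix.trace_mul_comm (pauli i), mul_comm]
  have hl (j : Fin 3) : sphereMean 2 (fun ψ => ((E (pauli j)).trace.re +
      (E 1 * pauli j).trace.re) * blochCoord j ψ) = 0 := by
    rw [sphereMean_const_mul]
    exact mul_eq_zero_of_right _ (sphereMean_blochCoord j)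
  simp only [hs, hl, Finset.mul_sum, Finset.sum_const_zero]
  ring

/-! ### The Pauli-diagonal part of a trace-preserving completely positive map -/

/-- The weight of the Pauli operator `pauli j` in `K`. -/
noncomputable def pauliWeight (K : Op 2) (j : Fin 3) : ℝ := Complex.normSq (pauli j * K).trace / 4

lemma pauliWeight_nonneg (K : Op 2) (j : Fin 3) : 0 ≤ pauliWeight K j :=
  div_nonneg (Complex.normSq_nonneg _) (by norm_num)

/-- For K = k_0 + ∑ k_i σ_i the weights are |k_i|². Moving σ_j past K changes the sign of the two
components with i ≠ 0, j, which costs 4|k_i|² each compared with tr K K†. -/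
lemma re_trace_pauli_mul_sandwich (K : Op 2) (j : Fin 3) :
    (pauli j * sandwich K (pauli j)).trace.re =
      (K * Kᴴ).trace.re + 4 * (pauliWeight K j - ∑ i, pauliWeight K i) := by
  revert j
  rw [forall_fin_three]
  refine ⟨?_, ?_, ?_⟩ <;>
  · simp [pauliWeight, sandwich_apply, Fin.sum_univ_three, pauli_zero, pauli_one, pauli_two,
      Matrix.trace_fin_two, Matrix.mul_apply, Complex.normSq_apply, -Matrix.cons_mul]
    ring

/-- In dimension two, the Pauli-diagonal entries of a trace-preserving completely positive map
are governed by three nonnegative weights, which vanish only for the identity. -/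
lemma IsTPCP.exists_weights {E : SuperOp 2} (hE : IsTPCP E) :
    ∃ p : Fin 3 → ℝ, (∀ j, 0 ≤ p j) ∧
      (∀ j, (pauli j * E (pauli j)).trace.re = 2 + 4 * (p j - ∑ i, p i)) ∧
      ((∀ j, p j = 0) → E = LinearMap.id) := by
  obtain ⟨K, hK⟩ := hE.exists_kraus
  have hsum : ∑ r, (K r * (K r)ᴴ).trace = 2 := by
    have := hE.2 1
    simpa [hK, Matrix.trace_sum] using this
  refine ⟨fun j => ∑ r, pauliWeight (K r) j, fun j => Finset.sum_nonneg fun r _ =>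
    pauliWeight_nonneg _ _, fun j => ?_, fun h => ?_⟩
  · have hsum' : ∑ r, (K r * (K r)ᴴ).trace.re = 2 := by
      rw [← Complex.re_sum, hsum]
      rfl
    have h1 (r) : (pauli j * (K r * pauli j * (K r)ᴴ)).trace.re =
        (K r * (K r)ᴴ).trace.re + 4 * (pauliWeight (K r) j - ∑ i, pauliWeight (K r) i) :=
      re_trace_pauli_mul_sandwich (K r) j
    rw [hK, Matrix.mul_sum, Matrix.trace_sum, Complex.re_sum]
    simp only [h1]
    rw [Finset.sum_add_distrib, hsum', ← Finset.mul_sum, Finset.sum_sub_distrib, Finset.sum_comm]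
  -- With no Pauli component each Kraus operator is scalar, so E is a multiple of the identity;
  -- trace preservation makes the factor 1.
  · have h0 (r j) : (pauli j * K r).trace = 0 := by
      have := (Finset.sum_eq_zero_iff_of_nonneg fun r _ => pauliWeight_nonneg (K r) j).1 (h j) r
        (Finset.mem_univ r)
      rw [pauliWeight] at this
      exact Complex.normSq_eq_zero.1 (by linarith)
    have hKr (r) : K r = ((1 / 2 : ℂ) * (K r).trace) • (1 : Op 2) := by
      conv_lhs => rw [eq_pauli_expansion (K r)]
      simp [h0, smul_smul]
    have hEX (X : Op 2) : E X = (∑ r, (1 / 2 : ℂ) * (K r).trace *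
        star ((1 / 2 : ℂ) * (K r).trace)) • X := by
      rw [hK, Finset.sum_smul]
      refine Finset.sum_congr rfl fun r _ => ?_
      rw [hKr r]
      simp only [Matrix.conjTranspose_smul, Matrix.conjTranspose_one, Matrix.smul_mul,
        Matrix.mul_smul, Matrix.one_mul, Matrix.mul_one, smul_smul]
      rw [← hKr r, mul_comm]
    have h1 := hE.2 1
    rw [hEX] at h1
    have h2 : (∑ r, (1 / 2 : ℂ) * (K r).trace * star ((1 / 2 : ℂ) * (K r).trace)) = 1 := by
      simpa using h1
    ext1 X
    rw [hEX, h2, one_smul, LinearMap.id_apply]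

/-! ### Pauli-diagonal normal form -/

lemma isCompact_unitaryGroup (d : ℕ) :
    IsCompact (Matrix.unitaryGroup (Fin d) ℂ : Set (Op d)) := by
  have : ProperSpace (Op d) := FiniteDimensional.proper ℂ _
  refine Metric.isCompact_of_isClosed_isBounded isClosed_unitary ?_
  refine (Metric.isBounded_closedBall (x := 0) (r := 1)).subset fun U hU => ?_
  rw [mem_closedBall_zero_iff]
  rcases subsingleton_or_nontrivial (Op d) with h | h
  · simp [Subsingleton.elim U 0]
  · exact (CStarRing.norm_of_mem_unitary hU).le

lemma continuous_sandwich_apply {d : ℕ} (X : Op d) : Continuous fun A : Op d => sandwich A X := by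
  simp only [sandwich_apply]
  exact (continuous_id.mul continuous_const).mul continuous_star

lemma trace_mul_sandwich {d : ℕ} (A X Y : Op d) :
    (X * sandwich A Y).trace = (sandwich Aᴴ X * Y).trace := by
  simp only [sandwich_apply, Matrix.conjTranspose_conjTranspose]
  rw [← Matrix.mul_assoc, Matrix.trace_mul_comm]
  simp only [Matrix.mul_assoc]

/-- A trigonometric polynomial of degree one that is maximal at zero has no sine term. -/
lemma eq_zero_of_cos_sin_le {α β γ : ℝ}
    (h : ∀ θ : ℝ, α * Real.cos θ + β * Real.sin θ + γ ≤ α + γ) : β = 0 := by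
  have hd : HasDerivAt (fun θ : ℝ => α * Real.cos θ + β * Real.sin θ)
      (α * -Real.sin 0 + β * Real.cos 0) 0 :=
    ((Real.hasDerivAt_cos 0).const_mul α).add ((Real.hasDerivAt_sin 0).const_mul β)
  have hm : IsLocalMax (fun θ : ℝ => α * Real.cos θ + β * Real.sin θ) 0 :=
    Filter.Eventually.of_forall fun θ => by
      have := h θ
      simp only [Real.cos_zero, Real.sin_zero]
      linarith
  simpa using hm.hasDerivAt_eq_zero hd

/-- The rotation by the angle `θ` about the axis `k`. -/
noncomputable def angleRotation (k : Fin 3) (θ : ℝ) : Op 2 :=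
  axisRotation k (Real.cos (θ / 2)) (Real.sin (θ / 2))

lemma angleRotation_mem_unitaryGroup (k : Fin 3) (θ : ℝ) :
    angleRotation k θ ∈ Matrix.unitaryGroup (Fin 2) ℂ :=
  axisRotation_mem_unitaryGroup k (Real.cos_sq_add_sin_sq _)

lemma sandwich_angleRotation_self (k : Fin 3) (θ : ℝ) :
    sandwich (angleRotation k θ) (pauli k) = pauli k :=
  sandwich_axisRotation_self k (Real.cos_sq_add_sin_sq _)

lemma sandwich_angleRotation_add_one (k : Fin 3) (θ : ℝ) :
    sandwich (angleRotation k θ) (pauli (k + 1)) =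
      (Real.cos θ : ℂ) • pauli (k + 1) - (Real.sin θ : ℂ) • pauli (k + 2) := by
  rw [angleRotation, sandwich_axisRotation_add_one, ← Real.cos_two_mul', mul_assoc,
    mul_comm (Real.cos _), ← mul_assoc, ← Real.sin_two_mul, mul_div_cancel₀ θ two_ne_zero]

lemma sandwich_angleRotation_add_two (k : Fin 3) (θ : ℝ) :
    sandwich (angleRotation k θ) (pauli (k + 2)) =
      (Real.cos θ : ℂ) • pauli (k + 2) + (Real.sin θ : ℂ) • pauli (k + 1) := by
  rw [angleRotation, sandwich_axisRotation_add_two, ← Real.cos_two_mul', mul_assoc,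
    mul_comm (Real.cos _), ← mul_assoc, ← Real.sin_two_mul, mul_div_cancel₀ θ two_ne_zero]

/-- The entries (up to a factor two) of a map of a qubit in the Pauli basis. -/
noncomputable def pauliEntry (E : SuperOp 2) (i j : Fin 3) : ℝ := (pauli i * E (pauli j)).trace.re

lemma sum_fin_three_cyclic {M : Type*} [AddCommMonoid M] (k : Fin 3) (f : Fin 3 → M) :
    ∑ j, f j = f k + (f (k + 1) + f (k + 2)) := by
  revert k
  rw [forall_fin_three, Fin.sum_univ_three]
  refine ⟨?_, ?_, ?_⟩
  · rw [add_assoc]; rfl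
  · change _ = f 1 + (f 2 + f 0)
    abel
  · change _ = f 2 + (f 0 + f 1)
    abel

/-- The two rotations turn the rows of the (k+1, k+2) block by θ and its columns by η, and fix the
entry at (k, k). -/
lemma sum_pauliEntry_rotate (k : Fin 3) (θ η : ℝ) (w : Fin 3 → ℝ) (E : SuperOp 2) :
    ∑ j, w j * pauliEntry (sandwich (angleRotation k θ)ᴴ ∘ₗ E ∘ₗ sandwich (angleRotation k η)) j j =
      w k * pauliEntry E k k +
      (w (k + 1) * (Real.cos θ * Real.cos η * pauliEntry E (k + 1) (k + 1)
          - Real.cos θ * Real.sin η * pauliEntry E (k + 1) (k + 2)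
          - Real.sin θ * Real.cos η * pauliEntry E (k + 2) (k + 1)
          + Real.sin θ * Real.sin η * pauliEntry E (k + 2) (k + 2)) +
       w (k + 2) * (Real.cos θ * Real.cos η * pauliEntry E (k + 2) (k + 2)
          + Real.cos θ * Real.sin η * pauliEntry E (k + 2) (k + 1)
          + Real.sin θ * Real.cos η * pauliEntry E (k + 1) (k + 2)
          + Real.sin θ * Real.sin η * pauliEntry E (k + 1) (k + 1))) := by
  rw [sum_fin_three_cyclic k]
  simp only [pauliEntry, LinearMap.comp_apply, trace_mul_sandwich,
    Matrix.conjTranspose_conjTranspose, sandwich_angleRotation_self,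
    sandwich_angleRotation_add_one, sandwich_angleRotation_add_two, map_add, map_sub, map_smul,
    Matrix.add_mul, Matrix.sub_mul, Matrix.mul_add, Matrix.mul_sub, Matrix.smul_mul,
    Matrix.mul_smul, Matrix.trace_add, Matrix.trace_sub, Matrix.trace_smul, smul_eq_mul,
    Complex.add_re, Complex.sub_re, Complex.re_ofReal_mul]
  ring

/-- The singular value decomposition by rotations, found by maximizing a weighted trace. -/
lemma exists_pauliEntry_diagonal (N : SuperOp 2) :
    ∃ U ∈ Matrix.unitaryGroup (Fin 2) ℂ, ∃ V ∈ Matrix.unitaryGroup (Fin 2) ℂ,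
      ∀ k : Fin 3, pauliEntry (sandwich U ∘ₗ N ∘ₗ sandwich V) (k + 1) (k + 2) = 0 ∧
        pauliEntry (sandwich U ∘ₗ N ∘ₗ sandwich V) (k + 2) (k + 1) = 0 ∧
        0 ≤ pauliEntry (sandwich U ∘ₗ N ∘ₗ sandwich V) (k + 1) (k + 1) +
          pauliEntry (sandwich U ∘ₗ N ∘ₗ sandwich V) (k + 2) (k + 2) := by
  -- Positive, pairwise distinct weights 1, 2, 3: equal weights would force only symmetry of the
  -- entries, not their vanishing off the diagonal.
  let w : Fin 3 → ℝ := fun j => (j : ℕ) + 1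
  let g : Op 2 × Op 2 → ℝ := fun p =>
    ∑ j, w j * pauliEntry (sandwich p.1 ∘ₗ N ∘ₗ sandwich p.2) j j
  have hN : Continuous N := LinearMap.continuous_of_finiteDimensional N
  have hg : Continuous g := by
    refine continuous_finsetSum _ fun j _ => continuous_const.mul ?_
    refine Complex.continuous_re.comp (Continuous.matrix_trace (continuous_const.mul ?_))
    change Continuous fun p : Op 2 × Op 2 => p.1 * N (sandwich p.2 (pauli j)) * p.1ᴴ
    exact (continuous_fst.mul (hN.comp ((continuous_sandwich_apply _).comp continuous_snd))).mul
      (continuous_star.comp continuous_fst)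
  obtain ⟨⟨U, V⟩, ⟨hU, hV⟩, hmax⟩ :=
    ((isCompact_unitaryGroup 2).prod (isCompact_unitaryGroup 2)).exists_isMaxOn
      ⟨(1, 1), one_mem _, one_mem _⟩ hg.continuousOn
  refine ⟨U, hU, V, hV, fun k => ?_⟩
  have hle (θ η : ℝ) := by
    have h1 := hmax (show ((angleRotation k θ)ᴴ * U, V * angleRotation k η) ∈ _ from
      ⟨mul_mem (conjTranspose_mem_unitaryGroup (angleRotation_mem_unitaryGroup k θ)) hU,
        mul_mem hV (angleRotation_mem_unitaryGroup k η)⟩)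
    have h2 := sum_pauliEntry_rotate k θ η w (sandwich U ∘ₗ N ∘ₗ sandwich V)
    have h3 : sandwich (angleRotation k θ)ᴴ ∘ₗ (sandwich U ∘ₗ N ∘ₗ sandwich V) ∘ₗ
        sandwich (angleRotation k η) =
        sandwich ((angleRotation k θ)ᴴ * U) ∘ₗ N ∘ₗ sandwich (V * angleRotation k η) := by
      rw [← sandwich_comp, ← sandwich_comp]
      rfl
    rw [h3] at h2
    have h4 : g (U, V) = _ := sum_fin_three_cyclic k _
    exact (h2.symm.trans_le h1).trans_eq h4
  set B := pauliEntry (sandwich U ∘ₗ N ∘ₗ sandwich V)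
  have hw1 : 0 < w (k + 1) := by positivity
  have hw2 : 0 < w (k + 2) := by positivity
  have hw : w (k + 1) - w (k + 2) ≠ 0 := by
    clear * -
    revert k
    rw [forall_fin_three]
    refine ⟨?_, ?_, ?_⟩ <;> simp [w] <;> norm_num
  -- Stationarity under left rotations alone; `hright` is the same for right rotations.
  have hleft : w (k + 2) * B (k + 1) (k + 2) - w (k + 1) * B (k + 2) (k + 1) = 0 := by
    refine eq_zero_of_cos_sin_le (α := w (k + 1) * B (k + 1) (k + 1) + w (k + 2) * B (k + 2) (k + 2))
      (γ := 0) fun θ => ?_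
    have := hle θ 0
    simp only [Real.cos_zero, Real.sin_zero] at this
    linarith
  have hright : w (k + 2) * B (k + 2) (k + 1) - w (k + 1) * B (k + 1) (k + 2) = 0 := by
    refine eq_zero_of_cos_sin_le (α := w (k + 1) * B (k + 1) (k + 1) + w (k + 2) * B (k + 2) (k + 2))
      (γ := 0) fun θ => ?_
    have := hle 0 θ
    simp only [Real.cos_zero, Real.sin_zero] at this
    linarith
  -- Up to sign, the determinant of the two linear equations for the off-diagonal entries.
  have hne : (w (k + 1) - w (k + 2)) * (w (k + 1) + w (k + 2)) ≠ 0 :=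
    mul_ne_zero hw (by positivity)
  refine ⟨?_, ?_, ?_⟩
  · refine (mul_eq_zero.1 ?_).resolve_left hne
    linear_combination -w (k + 2) * hleft - w (k + 1) * hright
  · refine (mul_eq_zero.1 ?_).resolve_left hne
    linear_combination -w (k + 1) * hleft - w (k + 2) * hright
  -- Opposite quarter turns swap the two diagonal entries and negate both.
  · have := hle (Real.pi / 2) (-(Real.pi / 2))
    simp only [Real.cos_neg, Real.sin_neg, Real.cos_pi_div_two, Real.sin_pi_div_two] at this
    refine nonneg_of_mul_nonneg_right (a := w (k + 1) + w (k + 2)) ?_ (by positivity)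
    linarith

/-- Up to unitary conjugations, every trace-preserving completely positive map of a qubit is
diagonal on the Pauli operators. -/
lemma IsTPCP.exists_pauli_normal_form {N : SuperOp 2} (hN : IsTPCP N) :
    ∃ U ∈ Matrix.unitaryGroup (Fin 2) ℂ, ∃ V ∈ Matrix.unitaryGroup (Fin 2) ℂ,
      ∃ (N' : SuperOp 2) (s : Fin 3 → ℝ), IsTPCP N' ∧
        N = sandwich U ∘ₗ N' ∘ₗ sandwich V ∧ IsPauliDiagonal N' s ∧ IsSignNormalized s := by
  obtain ⟨U, hU, V, hV, h⟩ := exists_pauliEntry_diagonal N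
  set N' := sandwich U ∘ₗ N ∘ₗ sandwich V with hN'
  have hT : IsTPCP N' := (isTPCP_sandwich hU).comp (hN.comp (isTPCP_sandwich hV))
  have hoff (i j : Fin 3) (hij : i ≠ j) :
      pauliEntry N' i j = 0 ∧ 0 ≤ pauliEntry N' i i + pauliEntry N' j j := by
    have hcases : (∃ k : Fin 3, i = k + 1 ∧ j = k + 2) ∨ ∃ k : Fin 3, i = k + 2 ∧ j = k + 1 := by
      clear * - hij
      decide +revert
    rcases hcases with ⟨k, rfl, rfl⟩ | ⟨k, rfl, rfl⟩
    · exact ⟨(h k).1, (h k).2.2⟩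
    · exact ⟨(h k).2.1, (add_comm _ _).trans_ge (h k).2.2⟩
  refine ⟨Uᴴ, conjTranspose_mem_unitaryGroup hU, Vᴴ, conjTranspose_mem_unitaryGroup hV, N',
    fun j => pauliEntry N' j j / 2, hT, ?_, fun j => ?_, fun i j hij => ?_⟩
  · calc N = (sandwich Uᴴ ∘ₗ sandwich U) ∘ₗ N ∘ₗ sandwich V ∘ₗ sandwich Vᴴ := by
          rw [sandwich_conjTranspose_comp hU, sandwich_comp_conjTranspose hV]
          rfl
      _ = _ := rfl
  -- Hermiticity makes the Pauli coefficients real; trace preservation removes the component along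
  -- 1.
  · have hherm : (N' (pauli j))ᴴ = N' (pauli j) := by
      rw [← hT.map_conjTranspose, pauli_conjTranspose]
    have htr (i : Fin 3) : (pauli i * N' (pauli j)).trace = (pauliEntry N' i j : ℂ) :=
      (trace_pauli_mul_isReal i hherm).symm
    conv_lhs => rw [eq_pauli_expansion (N' (pauli j))]
    rw [hT.2, trace_pauli, zero_smul, zero_add]
    simp only [htr]
    rw [Finset.sum_eq_single j (fun i _ hij => by simp [(hoff i j hij).1]) (by simp), smul_smul]
    congr 1
    push_cast
    ring
  · have := (hoff i j hij).2
    linarith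

/-! ### Optimal post-controls of Pauli-diagonal noise -/

/-- N need not be unital: of the image of 1 only its trace enters. -/
lemma avgFidelity_comp_pauliDiagonal {N C : SuperOp 2} {s : Fin 3 → ℝ}
    (htr : ∀ X, (C (N X)).trace = X.trace) (hs : IsPauliDiagonal N s) :
    avgFidelity (C ∘ₗ N) = (6 + ∑ j, s j * (pauli j * C (pauli j)).trace.re) / 12 := by
  rw [avgFidelity_eq, LinearMap.comp_apply, htr]
  have h2 : (1 : Op 2).trace.re = 2 := by simp
  have hj (j : Fin 3) : (pauli j * (C ∘ₗ N) (pauli j)).trace.re =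
      s j * (pauli j * C (pauli j)).trace.re := by
    rw [LinearMap.comp_apply, hs j, map_smul, Matrix.mul_smul, Matrix.trace_smul, smul_eq_mul,
      Complex.re_ofReal_mul]
  simp only [hj, h2]
  ring

/-- The loss of average fidelity caused by a post-control with Pauli weights `p`. -/
lemma avgFidelity_comp_eq_sub {N C : SuperOp 2} {s p : Fin 3 → ℝ}
    (hN : IsTPCP N) (hC : IsTPCP C) (hs : IsPauliDiagonal N s)
    (hp : ∀ j, (pauli j * C (pauli j)).trace.re = 2 + 4 * (p j - ∑ i, p i)) :
    avgFidelity (C ∘ₗ N) =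
      (6 + 2 * ∑ j, s j) / 12 - (∑ k, p k * (s (k + 1) + s (k + 2))) / 3 := by
  rw [avgFidelity_comp_pauliDiagonal (fun X => (hC.2 _).trans (hN.2 X)) hs]
  simp only [hp, Fin.sum_univ_three]
  change _ = (6 + 2 * (s 0 + s 1 + s 2)) / 12 -
    (p 0 * (s 1 + s 2) + p 1 * (s 2 + s 0) + p 2 * (s 0 + s 1)) / 3
  ring

lemma avgFidelity_pauliDiagonal {N : SuperOp 2} {s : Fin 3 → ℝ} (hN : IsTPCP N)
    (hs : IsPauliDiagonal N s) : avgFidelity N = (6 + 2 * ∑ j, s j) / 12 := by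
  have h := avgFidelity_comp_pauliDiagonal (C := LinearMap.id) (fun X => hN.2 X) hs
  rw [LinearMap.id_comp] at h
  simp only [h, LinearMap.id_apply, trace_pauli_mul_pauli, if_true, Complex.re_ofNat,
    ← Finset.sum_mul]
  ring

lemma sandwich_pauli_of_ne {k j : Fin 3} (h : j ≠ k) : sandwich (pauli k) (pauli j) = -pauli j := by
  rw [sandwich_apply, pauli_conjTranspose]
  have hj : j = k + 1 ∨ j = k + 2 := by decide +revert
  rcases hj with rfl | rfl
  · rw [pauli_mul_pauli_add_one, Matrix.smul_mul, pauli_add_two_mul_pauli, smul_smul,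
      Complex.I_mul_I, neg_one_smul]
  · rw [pauli_mul_pauli_add_two, Matrix.smul_mul, pauli_add_one_mul_pauli, smul_smul,
      neg_mul_neg, Complex.I_mul_I, neg_one_smul]

lemma sandwich_pauli_ne_id (k : Fin 3) : sandwich (pauli k) ≠ LinearMap.id := by
  intro h
  have hk : k + 1 ≠ k := by clear h; decide +revert
  have h1 := LinearMap.congr_fun h (pauli (k + 1))
  rw [sandwich_pauli_of_ne hk, LinearMap.id_apply] at h1
  have h2 := congrArg (fun X => (pauli (k + 1) * X).trace) h1
  simp only [Matrix.mul_neg, Matrix.trace_neg, trace_pauli_mul_pauli, if_true] at h2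
  norm_num at h2

/-- Conjugation by σ_k has the single weight p_k = 1, so it isolates one pair sum and ties with the
identity when that sum is zero. -/
lemma avgFidelity_sandwich_pauli_comp {N : SuperOp 2} {s : Fin 3 → ℝ} (hN : IsTPCP N)
    (hs : IsPauliDiagonal N s) (k : Fin 3) :
    avgFidelity (sandwich (pauli k) ∘ₗ N) = avgFidelity N - (s (k + 1) + s (k + 2)) / 3 := by
  have hp (j : Fin 3) : (pauli j * sandwich (pauli k) (pauli j)).trace.re =
      2 + 4 * ((Pi.single k 1 : Fin 3 → ℝ) j - ∑ i, (Pi.single k 1 : Fin 3 → ℝ) i) := by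
    rw [Finset.sum_pi_single' k (1 : ℝ), if_pos (Finset.mem_univ k)]
    by_cases hj : j = k
    · subst hj
      rw [sandwich_apply, pauli_conjTranspose, pauli_mul_self, Matrix.one_mul, pauli_mul_self]
      simp
    · rw [sandwich_pauli_of_ne hj, Matrix.mul_neg, pauli_mul_self]
      simp [hj]
      norm_num
  rw [avgFidelity_comp_eq_sub hN (isTPCP_sandwich (pauli_mem_unitaryGroup k)) hs hp,
    avgFidelity_pauliDiagonal hN hs]
  congr 2
  rw [Finset.sum_eq_single k (fun i _ hi => by simp [hi]) (by simp)]
  simp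

lemma IsSignNormalized.cyclic_nonneg {s : Fin 3 → ℝ} (h : IsSignNormalized s) (k : Fin 3) :
    0 ≤ s (k + 1) + s (k + 2) :=
  h _ _ (by clear * -; decide +revert)

/-- For a Pauli-diagonal map in sign-normalized form no post-control is better than none. -/
lemma isOptimalPostControl_id {N : SuperOp 2} {s : Fin 3 → ℝ} (hN : IsTPCP N)
    (hs : IsPauliDiagonal N s) (hsn : IsSignNormalized s) :
    IsOptimalPostControl N LinearMap.id := by
  refine ⟨sandwich_one (d := 2) ▸ isTPCP_sandwich (one_mem _), fun C hC => ?_⟩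
  obtain ⟨p, hp0, hp, -⟩ := hC.exists_weights
  rw [avgFidelity_comp_eq_sub hN hC hs hp, LinearMap.id_comp, avgFidelity_pauliDiagonal hN hs]
  have : 0 ≤ ∑ k, p k * (s (k + 1) + s (k + 2)) :=
    Finset.sum_nonneg fun k _ => mul_nonneg (hp0 k) (hsn.cyclic_nonneg k)
  linarith

lemma isOptimalPostControl_unique_iff {N : SuperOp 2} {s : Fin 3 → ℝ} (hN : IsTPCP N)
    (hs : IsPauliDiagonal N s) (hsn : IsSignNormalized s) :
    (∀ C, IsOptimalPostControl N C → C = LinearMap.id) ↔ ∀ i j, i ≠ j → 0 < s i + s j := by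
  have hid := isOptimalPostControl_id hN hs hsn
  constructor
  · intro h i j hij
    by_contra hneg
    have hzero : s i + s j = 0 := le_antisymm (not_lt.1 hneg) (hsn i j hij)
    obtain ⟨k, hk⟩ : ∃ k : Fin 3, s (k + 1) + s (k + 2) = 0 := by
      have hcases : (∃ k : Fin 3, i = k + 1 ∧ j = k + 2) ∨
          ∃ k : Fin 3, i = k + 2 ∧ j = k + 1 := by
        clear * - hij
        decide +revert
      rcases hcases with ⟨k, rfl, rfl⟩ | ⟨k, rfl, rfl⟩
      · exact ⟨k, hzero⟩
      · exact ⟨k, (add_comm _ _).trans hzero⟩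
    refine sandwich_pauli_ne_id k (h _ ⟨isTPCP_sandwich (pauli_mem_unitaryGroup k),
      fun C hC => (hid.2 C hC).trans_eq ?_⟩)
    rw [avgFidelity_sandwich_pauli_comp hN hs, hk, LinearMap.id_comp, zero_div, sub_zero]
  · intro hpos C hC
    obtain ⟨p, hp0, hp, hpid⟩ := hC.1.exists_weights
    have hle := hC.2 _ hid.1
    rw [avgFidelity_comp_eq_sub hN hC.1 hs hp, LinearMap.id_comp,
      avgFidelity_pauliDiagonal hN hs] at hle
    have hs' (k : Fin 3) : 0 < s (k + 1) + s (k + 2) :=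
      hpos _ _ (by clear * -; decide +revert)
    have hnn (k : Fin 3) : 0 ≤ p k * (s (k + 1) + s (k + 2)) := mul_nonneg (hp0 k) (hs' k).le
    have hsum : ∑ k, p k * (s (k + 1) + s (k + 2)) = 0 :=
      le_antisymm (by linarith) (Finset.sum_nonneg fun k _ => hnn k)
    refine hpid fun k => ?_
    have := (Finset.sum_eq_zero_iff_of_nonneg fun k _ => hnn k).1 hsum k (Finset.mem_univ k)
    exact (mul_eq_zero.1 this).resolve_right (hs' k).ne'

/-! ### Transport along unitary conjugations -/

section UnitaryEquivalence

variable {U V : Op 2} {N' : SuperOp 2}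

lemma isTPCP_conj_iff (hU : U ∈ Matrix.unitaryGroup (Fin 2) ℂ)
    (hV : V ∈ Matrix.unitaryGroup (Fin 2) ℂ) {E : SuperOp 2} :
    IsTPCP (sandwich U ∘ₗ E ∘ₗ sandwich V) ↔ IsTPCP E := by
  refine ⟨fun h => ?_, fun h => (isTPCP_sandwich hU).comp (h.comp (isTPCP_sandwich hV))⟩
  have h' := (isTPCP_sandwich (conjTranspose_mem_unitaryGroup hU)).comp
    (h.comp (isTPCP_sandwich (conjTranspose_mem_unitaryGroup hV)))
  have : sandwich Uᴴ ∘ₗ (sandwich U ∘ₗ E ∘ₗ sandwich V) ∘ₗ sandwich Vᴴ =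
      (sandwich Uᴴ ∘ₗ sandwich U) ∘ₗ E ∘ₗ (sandwich V ∘ₗ sandwich Vᴴ) := rfl
  rwa [this, sandwich_conjTranspose_comp hU, sandwich_comp_conjTranspose hV, LinearMap.id_comp,
    LinearMap.comp_id] at h'

/-- Post-controls for `U N' V` correspond to post-controls for `N'`. -/
lemma avgFidelity_comp_conj (hV : V ∈ Matrix.unitaryGroup (Fin 2) ℂ) (C : SuperOp 2) :
    avgFidelity (C ∘ₗ sandwich U ∘ₗ N' ∘ₗ sandwich V) =
      avgFidelity ((sandwich V ∘ₗ C ∘ₗ sandwich U) ∘ₗ N') := by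
  rw [← avgFidelity_conj hV]
  have : sandwich V ∘ₗ (C ∘ₗ sandwich U ∘ₗ N' ∘ₗ sandwich V) ∘ₗ sandwich Vᴴ =
      (sandwich V ∘ₗ C ∘ₗ sandwich U) ∘ₗ N' ∘ₗ (sandwich V ∘ₗ sandwich Vᴴ) := rfl
  rw [this, sandwich_comp_conjTranspose hV, LinearMap.comp_id]

lemma conj_conjTranspose_conj (hU : U ∈ Matrix.unitaryGroup (Fin 2) ℂ)
    (hV : V ∈ Matrix.unitaryGroup (Fin 2) ℂ) (E : SuperOp 2) :
    sandwich V ∘ₗ (sandwich Vᴴ ∘ₗ E ∘ₗ sandwich Uᴴ) ∘ₗ sandwich U = E := by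
  have : sandwich V ∘ₗ (sandwich Vᴴ ∘ₗ E ∘ₗ sandwich Uᴴ) ∘ₗ sandwich U =
      (sandwich V ∘ₗ sandwich Vᴴ) ∘ₗ E ∘ₗ (sandwich Uᴴ ∘ₗ sandwich U) := rfl
  rw [this, sandwich_comp_conjTranspose hV, sandwich_conjTranspose_comp hU, LinearMap.id_comp,
    LinearMap.comp_id]

/-- The substitution C ↦ V C U is a bijection of the TPCP maps that matches the two average
fidelities. -/
lemma isOptimalPostControl_conj_iff (hU : U ∈ Matrix.unitaryGroup (Fin 2) ℂ)
    (hV : V ∈ Matrix.unitaryGroup (Fin 2) ℂ) (C : SuperOp 2) :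
    IsOptimalPostControl (sandwich U ∘ₗ N' ∘ₗ sandwich V) C ↔
      IsOptimalPostControl N' (sandwich V ∘ₗ C ∘ₗ sandwich U) := by
  refine and_congr (isTPCP_conj_iff hV hU).symm ⟨fun h C' hC' => ?_, fun h C' hC' => ?_⟩
  · have := h _ ((isTPCP_conj_iff (conjTranspose_mem_unitaryGroup hV)
      (conjTranspose_mem_unitaryGroup hU)).2 hC')
    rwa [avgFidelity_comp_conj hV, avgFidelity_comp_conj hV, conj_conjTranspose_conj hU hV] at this
  · rw [avgFidelity_comp_conj hV, avgFidelity_comp_conj hV]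
    exact h _ ((isTPCP_conj_iff hV hU).2 hC')

lemma conj_eq_id_iff (hU : U ∈ Matrix.unitaryGroup (Fin 2) ℂ)
    (hV : V ∈ Matrix.unitaryGroup (Fin 2) ℂ) (C : SuperOp 2) :
    sandwich V ∘ₗ C ∘ₗ sandwich U = LinearMap.id ↔ C = sandwich (U * V)ᴴ := by
  have hC : sandwich (U * V)ᴴ = sandwich Vᴴ ∘ₗ LinearMap.id ∘ₗ sandwich Uᴴ := by
    rw [LinearMap.id_comp, sandwich_comp, Matrix.conjTranspose_mul]
  constructor
  · intro h
    rw [hC, ← h]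
    have := conj_conjTranspose_conj (conjTranspose_mem_unitaryGroup hU)
      (conjTranspose_mem_unitaryGroup hV) C
    rw [Matrix.conjTranspose_conjTranspose, Matrix.conjTranspose_conjTranspose] at this
    exact this.symm
  · rintro rfl
    rw [hC, conj_conjTranspose_conj hU hV]

end UnitaryEquivalence

theorem theorem1 (N : SuperOp 2) (hN : IsTPCP N) :
    (∃ U ∈ Matrix.unitaryGroup (Fin 2) ℂ, ∃ V ∈ Matrix.unitaryGroup (Fin 2) ℂ,
      ∃ (N' : SuperOp 2) (s : Fin 3 → ℝ), IsTPCP N' ∧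
        N = sandwich U ∘ₗ N' ∘ₗ sandwich V ∧ IsPauliDiagonal N' s ∧ IsSignNormalized s) ∧
    (∀ U ∈ Matrix.unitaryGroup (Fin 2) ℂ, ∀ V ∈ Matrix.unitaryGroup (Fin 2) ℂ,
      ∀ (N' : SuperOp 2) (s : Fin 3 → ℝ),
        N = sandwich U ∘ₗ N' ∘ₗ sandwich V → IsPauliDiagonal N' s → IsSignNormalized s →
          IsOptimalPostControl N (sandwich (U * V)ᴴ) ∧
          (avgFidelity (sandwich (U * V)ᴴ ∘ₗ N) : ℂ)
            = (6 + ∑ j, (pauli j * N' (pauli j)).trace) / 12 ∧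
          ((∀ C : SuperOp 2, IsOptimalPostControl N C → C = sandwich (U * V)ᴴ) ↔
            ∀ i j, i ≠ j → 0 < s i + s j)) := by
  refine ⟨hN.exists_pauli_normal_form, ?_⟩
  rintro U hU V hV N' s rfl hs hsn
  -- Here `N'` is only assumed linear; the TPCP property is inherited from the noise by undoing the
  -- unitaries.
  have hN' : IsTPCP N' := (isTPCP_conj_iff hU hV).1 hN
  have hid := (conj_eq_id_iff hU hV (sandwich (U * V)ᴴ)).2 rfl
  refine ⟨?_, ?_, ?_⟩
  · rw [isOptimalPostControl_conj_iff hU hV, hid]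
    exact isOptimalPostControl_id hN' hs hsn
  · rw [avgFidelity_comp_conj hV, hid, LinearMap.id_comp, avgFidelity_pauliDiagonal hN' hs]
    have hj (j : Fin 3) : (pauli j * N' (pauli j)).trace = 2 * (s j : ℂ) := by
      rw [hs j, Matrix.mul_smul, Matrix.trace_smul, trace_pauli_mul_pauli, if_pos rfl, smul_eq_mul,
        mul_comm]
    simp only [hj, ← Finset.mul_sum]
    push_cast
    rfl
  · rw [← isOptimalPostControl_unique_iff hN' hs hsn]
    constructor
    · intro h C hC
      rw [← conj_conjTranspose_conj hU hV C] at hC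
      have := h _ ((isOptimalPostControl_conj_iff hU hV _).2 hC)
      rwa [← conj_eq_id_iff hU hV, conj_conjTranspose_conj hU hV] at this
    · intro h C hC
      rw [← conj_eq_id_iff hU hV]
      exact h _ ((isOptimalPostControl_conj_iff hU hV C).1 hC)
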